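/- Let $1\le p<\infty$. Let $\ell_p$ be the Banach space of real sequences $x=(x(n))_n$ with $\|x\|=\big(\sum_n|x(n)|^p\big)^{1/p}<\infty$, let $c_0$ be the Banach space of real sequences tending to $0$ with the supremum norm, and let $\ell_p^+\subset\ell_p$ and $c_0^+\subset c_0$ be the subsets of sequences all of whose terms are $\ge 0$, with the induced metrics. For metric spaces $(M,d)$ and $(N,\rho)$ and a real number $K$, a Lipschitz embedding of $M$ into $N$ with constant $K$ is a map $f:M\to N$ such that $d(x,y)\le\rho(f(x),f(y))\le K\,d(x,y)$ for all $x,y\in M$. Then: (i) There is a Lipschitz embedding of $\ell_p$ into $c_0^+$ with constant $(2^p+1)^{1/p}$, and this is best possible: for no $K<(2^p+1)^{1/p}$ is there a Lipschitz embedding of $\ell_p$ into $c_0^+$ with constant $K$. (ii) There is a Lipschitz embedding of $\ell_p^+$ into $c_0^+$ with constant $3^{1/p}$, and this is best possible: for no $K<3^{1/p}$ is there a Lipschitz embedding of $\ell_p^+$ into $c_0^+$ with constant $K$. -/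

import Mathlib

open scoped ENNReal ZeroAtInfty

/-- `f` is a Lipschitz embedding with constant `K`:
`d(x,y) ≤ d(f x, f y) ≤ K d(x,y)` for all `x, y`. -/
def IsLipschitzEmbedding {M N : Type*} [MetricSpace M] [MetricSpace N] (K : ℝ) (f : M → N) :
    Prop :=
  ∀ x y : M, dist x y ≤ dist (f x) (f y) ∧ dist (f x) (f y) ≤ K * dist x y

/-- `M` admits a Lipschitz embedding into `N` with constant `K`. -/
def LipschitzEmbeds (M N : Type*) [MetricSpace M] [MetricSpace N] (K : ℝ) : Prop :=
  ∃ f : M → N, IsLipschitzEmbedding K f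

/-- The positive cone of `c₀`. Here `c₀` is `C₀(ℕ, ℝ)`: since `ℕ` is discrete, these are exactly
the real sequences tending to `0`, with the supremum norm. -/
def c0Pos : Set C₀(ℕ, ℝ) := {f | ∀ n, 0 ≤ f n}

/-- The positive cone of the real sequence space `ℓ_p`. -/
def lpPos (p : ℝ≥0∞) : Set (lp (fun _ : ℕ => ℝ) p) := {x | ∀ n, 0 ≤ x n}

/-!
Write `q = p.toReal` and `d` for the distance of `ℓ_p`.

**Existence.** An embedding into `c₀⁺` is a countable family of nonnegative `K`-Lipschitz functions,
only finitely many of which exceed a given `η > 0` at a given point, such that every pair `x, y` is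
separated by `d x y` by one of them (`lipschitzEmbeds_c0Pos_of_family`). The functions are cones of
slope `K` over sets `U`. Fix a dense sequence `u` of finitely supported vectors and a pair at
distance `s`. The index of a point is the first `n` for which `u n` is within about `s / K` of it,
and the cone is put around the point of the pair with the larger index `n`. Since the earlier `u i`
are at distance at least about `s / K` from that point, a cone of height `s` nearly vanishes at all
`u i` with `i < n`; by density the functions tend to zero everywhere. Both points have tails of norm
at most about `s / K` beyond the coordinate `n`. If differences of tails are at most `A` times the
larger tail (`TailBound`), the first `n` coordinates carry at least
`(s ^ q - A ^ q * (s / K) ^ q) ^ (1 / q)`, which is `s / K` exactly if `K ^ q = A ^ q + 1`. So the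
cone may be taken over all points sharing, up to a small error, the first `n` coordinates, and by
compactness finitely many cones suffice for each `n` (`exists_finite_bumps`). The errors depend on
`n` and tend to zero, which gives the exact constant. In `ℓ_p` one has `A = 2`
(`tailBound_univ`), in the cone `A ^ q = 2` (`tailBound_lpPos`).

**Optimality.** Let `e` be a unit vector, and consider points `X = e + b` and `Y = b'`, where `b`,
`b'` are blocks of norm at most `1` with alternating coefficients on an increasing tuple of
coordinates far from `e`. If `K < d X Y`, positivity allows only finitely many coordinates of `c₀`
to separate `X` from `Y`, because such a coordinate must be large at `0` or at `e`. Shift graphs have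
infinite chromatic number (`exists_strictMono_init_tail_eq_color`), so some tuple and its shift
yield pairs `X₁, Y₁` and `X₂, Y₂` separated by the same coordinate with the same sign. Shifting
nearly exchanges `b` and `b'`, so that `d X₁ Y₂` and `d X₂ Y₁` are
about `1`, and adding the two inequalities gives `d X Y ≤ K` in the limit
(`le_mul_of_shift_exchange`). The choices `b' = -b`, and `b`, `b'` disjoint and nonnegative, make
`d X Y ^ q` equal to `1 + 2 ^ q` and `3`.
-/

/-! ### Sequences tending to zero -/

theorem abs_apply_sub_le_dist (f g : C₀(ℕ, ℝ)) (n : ℕ) : |f n - g n| ≤ dist f g := by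
  rw [← ZeroAtInftyContinuousMap.dist_toBCF_eq_dist]
  exact BoundedContinuousFunction.dist_coe_le_dist (f := f.toBCF) (g := g.toBCF) n

theorem dist_le_of_forall_abs_apply_sub_le {f g : C₀(ℕ, ℝ)} {C : ℝ} (hC : 0 ≤ C)
    (h : ∀ n, |f n - g n| ≤ C) : dist f g ≤ C := by
  rw [← ZeroAtInftyContinuousMap.dist_toBCF_eq_dist]
  exact (BoundedContinuousFunction.dist_le hC).2 h

theorem tendsto_apply_atTop (f : C₀(ℕ, ℝ)) :
    Filter.Tendsto (fun n => f n) Filter.atTop (nhds 0) := by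
  have h := f.zero_at_infty'
  rwa [Filter.cocompact_eq_cofinite, Nat.cofinite_eq_atTop] at h

/-- A countable family that is pointwise `c₀` is an embedding into `c₀⁺`, after numbering its
members and padding with zeros. -/
theorem lipschitzEmbeds_c0Pos_of_family {M ι : Type*} [MetricSpace M] [Countable ι] {K : ℝ}
    (hK : 0 ≤ K) (f : ι → M → ℝ) (h0 : ∀ i z, 0 ≤ f i z)
    (hL : ∀ i x y, |f i x - f i y| ≤ K * dist x y)
    (hfin : ∀ z, ∀ η > 0, {i | η ≤ f i z}.Finite)
    (hsep : ∀ x y, x ≠ y → ∃ i, dist x y ≤ |f i x - f i y|) :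
    LipschitzEmbeds M c0Pos K := by
  obtain ⟨e, he⟩ := exists_injective_nat ι
  have hval : ∀ z n, (∃ i, e i = n ∧ Function.extend e (fun i => f i z) 0 n = f i z) ∨
      ((¬ ∃ i, e i = n) ∧ Function.extend e (fun i => f i z) 0 n = 0) := by
    intro z n
    by_cases hn : ∃ i, e i = n
    · obtain ⟨i, rfl⟩ := hn
      exact Or.inl ⟨i, rfl, he.extend_apply _ _ _⟩
    · exact Or.inr ⟨hn, by rw [Function.extend_apply' _ _ _ hn]; rfl⟩
  let g : M → C₀(ℕ, ℝ) := fun z =>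
    { toFun := Function.extend e (fun i => f i z) 0
      continuous_toFun := continuous_of_discreteTopology
      zero_at_infty' := by
        rw [Filter.cocompact_eq_cofinite, Metric.tendsto_nhds]
        intro η hη
        rw [Filter.eventually_cofinite]
        refine ((hfin z η hη).image e).subset fun n hn => ?_
        rcases hval z n with ⟨i, rfl, hi⟩ | ⟨_, hi⟩
        · refine ⟨i, ?_, rfl⟩
          simpa [hi, abs_of_nonneg (h0 i z)] using hn
        · exact absurd (show dist _ (0 : ℝ) < η by rw [hi, dist_self]; exact hη) hn }
  have hg : ∀ z n, g z n = Function.extend e (fun i => f i z) 0 n := fun _ _ => rfl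
  have hge : ∀ z i, g z (e i) = f i z := fun z i =>
    (hg z (e i)).trans (he.extend_apply _ _ _)
  refine ⟨fun z => ⟨g z, fun n => ?_⟩, fun x y => ⟨?_, ?_⟩⟩
  · rw [hg]
    rcases hval z n with ⟨i, _, hi⟩ | ⟨_, hi⟩
    · rw [hi]; exact h0 i z
    · rw [hi]
  · by_cases hxy : x = y
    · subst hxy; simp
    · obtain ⟨i, hi⟩ := hsep x y hxy
      refine hi.trans ?_
      rw [← hge x i, ← hge y i]
      exact abs_apply_sub_le_dist _ _ _
  · refine dist_le_of_forall_abs_apply_sub_le (by positivity) fun n => ?_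
    change |g x n - g y n| ≤ _
    by_cases hn : ∃ i, e i = n
    · obtain ⟨i, rfl⟩ := hn
      rw [hge, hge]; exact hL i x y
    · rw [hg, hg, Function.extend_apply' _ _ _ hn, Function.extend_apply' _ _ _ hn]
      simp only [Pi.zero_apply, sub_self, abs_zero]
      positivity

/-! ### A colouring lemma for increasing tuples -/

/-- Shift graphs have infinite chromatic number. From a colouring of tuples of length `N + 2` one
passes to the colouring of tuples of length `N + 1` by the *set* of colours of their extensions. -/
theorem exists_strictMono_init_tail_eq_color (N : ℕ) : ∀ {C : Type} [Finite C]
    (χ : (Fin (N + 1) → ℕ) → C),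
    ∃ j : Fin (N + 2) → ℕ, StrictMono j ∧ χ (Fin.init j) = χ (Fin.tail j) := by
  induction N with
  | zero =>
    intro C _ χ
    obtain ⟨a, b, hab, h⟩ := Finite.exists_ne_map_eq_of_infinite fun n : ℕ => χ fun _ => n
    wlog hlt : a < b generalizing a b
    · exact this b a hab.symm h.symm (lt_of_le_of_ne (not_lt.1 hlt) hab.symm)
    refine ⟨![a, b], ?_, ?_⟩
    · rw [Fin.strictMono_iff_lt_succ]
      intro i
      fin_cases i
      simpa using hlt
    · convert h using 2
      · ext i; fin_cases i; rfl
      · ext i; fin_cases i; rfl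
  | succ N ih =>
    intro C _ χ
    obtain ⟨j, hj, hχ⟩ := ih fun t => {c : C | ∃ m, t (Fin.last N) < m ∧ χ (Fin.snoc t m) = c}
    have hmem : χ j ∈ {c : C | ∃ m, Fin.init j (Fin.last N) < m ∧
        χ (Fin.snoc (Fin.init j) m) = c} :=
      ⟨j (Fin.last _), hj (Fin.castSucc_lt_last _), by rw [Fin.snoc_init_self]⟩
    rw [hχ] at hmem
    obtain ⟨m, hm, hc⟩ := hmem
    refine ⟨Fin.snoc j m, ?_, ?_⟩
    · rw [Fin.strictMono_iff_lt_succ]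
      intro i
      induction i using Fin.lastCases with
      | last =>
        rw [Fin.succ_last, Fin.snoc_last, Fin.snoc_castSucc]
        exact hm
      | cast i =>
        rw [Fin.snoc_castSucc, ← Fin.castSucc_succ, Fin.snoc_castSucc]
        exact hj (Fin.castSucc_lt_succ)
    · rw [Fin.init_snoc, ← hc]
      congr 1
      ext i
      induction i using Fin.lastCases with
      | last =>
        rw [Fin.snoc_last, Fin.tail, Fin.succ_last, Fin.snoc_last]
      | cast i => simp [Fin.tail, ← Fin.castSucc_succ]

/-! ### The obstruction to embedding into the positive cone -/

/-- If `P` and `O` are centres, `X t` and `Y t` are points near them, and shifting the tuple nearly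
exchanges the roles of `X` and `Y`, then two shifted tuples whose images are separated by the same
coordinate with the same sign bound the distance `dist (X t) (Y t)`. Positivity confines the
separating coordinates to a finite set: far out `f P` and `f O` almost vanish, so a nonnegative
value as large as `s` at `X t` or `Y t` is impossible. -/
theorem le_mul_of_shift_exchange {E : Type*} [PseudoMetricSpace E] {M : Set E}
    {f : E → C₀(ℕ, ℝ)} {K s η : ℝ} (hK : 0 ≤ K) (hη : 0 ≤ η)
    (hpos : ∀ x ∈ M, ∀ n, 0 ≤ f x n)
    (hlow : ∀ x ∈ M, ∀ y ∈ M, dist x y ≤ dist (f x) (f y))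
    (hup : ∀ x ∈ M, ∀ y ∈ M, dist (f x) (f y) ≤ K * dist x y)
    {P O : E} (hP : P ∈ M) (hO : O ∈ M) {N : ℕ} (X Y : (Fin (N + 1) → ℕ) → E)
    (hXM : ∀ t, X t ∈ M) (hYM : ∀ t, Y t ∈ M)
    (hX : ∀ t, StrictMono t → dist (X t) P ≤ 1) (hY : ∀ t, StrictMono t → dist (Y t) O ≤ 1)
    (hXY : ∀ t, StrictMono t → s ≤ dist (X t) (Y t))
    (hXY' : ∀ j : Fin (N + 2) → ℕ, StrictMono j → dist (X (Fin.init j)) (Y (Fin.tail j)) ≤ 1 + η)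
    (hYX' : ∀ j : Fin (N + 2) → ℕ, StrictMono j → dist (X (Fin.tail j)) (Y (Fin.init j)) ≤ 1 + η) :
    s ≤ K * (1 + η) := by
  by_contra! hlt
  obtain ⟨r, hr, hrs⟩ := exists_between hlt
  have hKr : K < r := by nlinarith
  have hcoord : ∀ x ∈ M, ∀ y ∈ M, ∀ c, dist x y ≤ c → ∀ n, |f x n - f y n| ≤ K * c :=
    fun x hx y hy c hc n => (abs_apply_sub_le_dist _ _ n).trans
      ((hup x hx y hy).trans (mul_le_mul_of_nonneg_left hc hK))
  obtain ⟨n₀, hn₀⟩ : ∃ n₀, ∀ n ≥ n₀, f P n < r - K ∧ f O n < r - K := by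
    have h1 := (tendsto_apply_atTop (f P)).eventually_lt_const (sub_pos.2 hKr)
    have h2 := (tendsto_apply_atTop (f O)).eventually_lt_const (sub_pos.2 hKr)
    exact Filter.eventually_atTop.1 (h1.and h2)
  have hcol : ∀ t, ∃ c : Fin (n₀ + 1) × Bool, StrictMono t →
      (if c.2 then r ≤ f (X t) c.1 - f (Y t) c.1 else r ≤ f (Y t) c.1 - f (X t) c.1) := by
    intro t
    by_cases ht : StrictMono t
    · obtain ⟨n, hn⟩ : ∃ n, r < |f (X t) n - f (Y t) n| := by
        by_contra! hcon
        have h := dist_le_of_forall_abs_apply_sub_le (by linarith) hcon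
        linarith [hXY t ht, hlow _ (hXM t) _ (hYM t)]
      have hnlt : n < n₀ := by
        by_contra! hge
        have hx := abs_le.1 (hcoord _ (hXM t) _ hP 1 (hX t ht) n)
        have hy := abs_le.1 (hcoord _ (hYM t) _ hO 1 (hY t ht) n)
        have hx0 := hpos _ (hXM t) n
        have hy0 := hpos _ (hYM t) n
        have h := hn₀ n hge
        rcases lt_abs.1 hn with hn | hn <;> linarith
      rcases lt_abs.1 hn with hn | hn
      · exact ⟨(⟨n, by omega⟩, true), fun _ => by simpa using hn.le⟩
      · exact ⟨(⟨n, by omega⟩, false), fun _ => by simp; linarith⟩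
    · exact ⟨(0, true), fun h => absurd h ht⟩
  choose χ hχ using hcol
  obtain ⟨j, hj, hc⟩ := exists_strictMono_init_tail_eq_color N χ
  have hi : StrictMono (Fin.init j) := fun a b hab => hj (Fin.castSucc_lt_castSucc_iff.2 hab)
  have ht : StrictMono (Fin.tail j) := fun a b hab => hj (Fin.succ_lt_succ_iff.2 hab)
  have h1 := hχ _ hi
  have h2 := hχ _ ht
  rw [← hc] at h2
  set n : ℕ := ((χ (Fin.init j)).1).val
  have h3 := abs_le.1 (hcoord _ (hXM _) _ (hYM _) _ (hXY' j hj) n)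
  have h4 := abs_le.1 (hcoord _ (hXM _) _ (hYM _) _ (hYX' j hj) n)
  by_cases hb : (χ (Fin.init j)).2 = true
  · rw [if_pos hb] at h1 h2; linarith
  · rw [if_neg hb] at h1 h2; linarith

/-! ### Blocks of unit vectors in `ℓ_p` -/

section Blocks

variable {p : ℝ≥0∞} [Fact (1 ≤ p)]

theorem toReal_pos_of_fact (hp : p ≠ ∞) : 0 < p.toReal :=
  ENNReal.toReal_pos (zero_lt_one.trans_le Fact.out).ne' hp

theorem one_le_toReal_of_fact (hp : p ≠ ∞) : 1 ≤ p.toReal := by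
  simpa using ENNReal.toReal_mono hp (Fact.out : 1 ≤ p)

/-- The block `∑ i < L, α i • e (t i + 1)`; the unit vector `e 0` is kept free. -/
noncomputable def block (p : ℝ≥0∞) [Fact (1 ≤ p)] (α : ℕ → ℝ) {L : ℕ} (t : Fin L → ℕ) :
    lp (fun _ : ℕ => ℝ) p :=
  ∑ i, lp.single p (t i + 1) (α i)

theorem norm_rpow_sum_single (hp : p ≠ ∞) {ι : Type*} [Fintype ι] (c : ι → ℝ) {t : ι → ℕ}
    (ht : Function.Injective t) :
    ‖∑ i, (lp.single p (t i) (c i) : lp (fun _ : ℕ => ℝ) p)‖ ^ p.toReal =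
      ∑ i, |c i| ^ p.toReal := by
  have h := lp.norm_sum_single (E := fun _ : ℕ => ℝ) (toReal_pos_of_fact hp)
    (Function.extend t c 0) (Finset.univ.map ⟨t, ht⟩)
  simpa [Finset.sum_map, ht.extend_apply] using h

theorem norm_rpow_block (hp : p ≠ ∞) (α : ℕ → ℝ) {L : ℕ} {t : Fin L → ℕ}
    (ht : Function.Injective t) :
    ‖block p α t‖ ^ p.toReal = ∑ i ∈ Finset.range L, |α i| ^ p.toReal := by
  rw [block, norm_rpow_sum_single hp (fun i : Fin L => α i)
    (fun a b h => ht (Nat.succ_injective h)),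
    Fin.sum_univ_eq_sum_range (fun i => |α i| ^ p.toReal)]

theorem norm_rpow_single_add_block (hp : p ≠ ∞) (α : ℕ → ℝ) {L : ℕ} {t : Fin L → ℕ}
    (ht : Function.Injective t) :
    ‖lp.single p 0 1 + block p α t‖ ^ p.toReal =
      1 + ∑ i ∈ Finset.range L, |α i| ^ p.toReal := by
  have hinj : Function.Injective (Fin.cons 0 (fun i => t i + 1) : Fin (L + 1) → ℕ) := by
    rw [Fin.cons_injective_iff]
    exact ⟨by simp, fun a b h => ht (Nat.succ_injective h)⟩
  have h := norm_rpow_sum_single hp (Fin.cons 1 (fun i : Fin L => α i) : Fin (L + 1) → ℝ) hinj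
  simp only [Fin.sum_univ_succ, Fin.cons_zero, Fin.cons_succ, abs_one, Real.one_rpow] at h
  rw [block, h, Fin.sum_univ_eq_sum_range (fun i => |α i| ^ p.toReal)]

theorem block_sub_block (α β : ℕ → ℝ) {L : ℕ} (t : Fin L → ℕ) :
    block p α t - block p β t = block p (fun i => α i - β i) t := by
  simp only [block, lp.single_sub, Finset.sum_sub_distrib]

/-- Shifting coefficients and positions simultaneously changes a block only at its two ends. -/
theorem block_init_sub_block_tail (α : ℕ → ℝ) {L : ℕ} (j : Fin (L + 1) → ℕ) :
    block p α (Fin.init j) - block p (fun i => α (i + 1)) (Fin.tail j) =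
      lp.single p (j 0 + 1) (α 0) - lp.single p (j (Fin.last L) + 1) (α L) := by
  have h1 := Fin.sum_univ_castSucc
    fun i : Fin (L + 1) => (lp.single p (j i + 1) (α i) : lp (fun _ : ℕ => ℝ) p)
  have h2 := Fin.sum_univ_succ
    fun i : Fin (L + 1) => (lp.single p (j i + 1) (α i) : lp (fun _ : ℕ => ℝ) p)
  simp only [Fin.val_castSucc, Fin.val_last, Fin.val_succ, Fin.val_zero] at h1 h2
  rw [h1] at h2
  simp only [block, Fin.init, Fin.tail]
  rw [sub_eq_sub_iff_add_eq_add, h2]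

theorem norm_block_init_sub_block_tail_le (α : ℕ → ℝ) {c : ℝ} (hc : ∀ i, |α i| ≤ c) {L : ℕ}
    (j : Fin (L + 1) → ℕ) :
    ‖block p α (Fin.init j) - block p (fun i => α (i + 1)) (Fin.tail j)‖ ≤ 2 * c := by
  have hp0 : 0 < p := zero_lt_one.trans_le Fact.out
  rw [block_init_sub_block_tail]
  refine (norm_sub_le _ _).trans ?_
  rw [lp.norm_single hp0, lp.norm_single hp0, Real.norm_eq_abs, Real.norm_eq_abs]
  linarith [hc 0, hc L]

theorem block_apply_nonneg {α : ℕ → ℝ} (hα : ∀ i, 0 ≤ α i) {L : ℕ} (t : Fin L → ℕ) (n : ℕ) :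
    0 ≤ block p α t n := by
  rw [block, lp.coeFn_sum, Finset.sum_apply]
  refine Finset.sum_nonneg fun i _ => ?_
  rw [lp.single_apply]
  by_cases h : n = t i + 1
  · subst h; simpa using hα i
  · rw [Pi.single_eq_of_ne h]

end Blocks

/-! ### Lower bounds for the constant -/

/-- The sequence `a, b, a, b, …`. -/
def alternating (a b : ℝ) (i : ℕ) : ℝ := if Even i then a else b

theorem alternating_succ (a b : ℝ) (i : ℕ) : alternating a b (i + 1) = alternating b a i := by
  by_cases h : Even i <;> simp [alternating, h, Nat.even_add_one]

theorem sum_range_alternating (g : ℝ → ℝ) (a b : ℝ) (N : ℕ) :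
    ∑ i ∈ Finset.range (2 * N), g (alternating a b i) = N * (g a + g b) := by
  induction N with
  | zero => simp
  | succ N ih =>
    rw [mul_add_one, Finset.sum_range_succ, Finset.sum_range_succ, ih, alternating_succ]
    simp [alternating]
    ring

section Lower

variable {p : ℝ≥0∞} [Fact (1 ≤ p)]

/-- The centres are `e 0` and `0`, the points near them `e 0 + (a, b, a, b, …)` and
`(b, a, b, a, …)` along an increasing tuple of coordinates. Shifting the tuple by one position
exchanges the two blocks up to two end terms of norm at most `c`. -/
theorem rpow_le_mul_of_alternating_blocks (hp : p ≠ ∞) {M : Set (lp (fun _ : ℕ => ℝ) p)}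
    {f : lp (fun _ : ℕ => ℝ) p → C₀(ℕ, ℝ)} {K S : ℝ} (hK : 0 ≤ K)
    (hpos : ∀ x ∈ M, ∀ n, 0 ≤ f x n)
    (hlow : ∀ x ∈ M, ∀ y ∈ M, dist x y ≤ dist (f x) (f y))
    (hup : ∀ x ∈ M, ∀ y ∈ M, dist (f x) (f y) ≤ K * dist x y)
    {N : ℕ} (hN : N ≠ 0) {a b c : ℝ} (ha : |a| ≤ c) (hb : |b| ≤ c)
    (hab : N * (|a| ^ p.toReal + |b| ^ p.toReal) ≤ 1)
    (hS : S ≤ N * (2 * |a - b| ^ p.toReal))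
    (h0M : 0 ∈ M) (h1M : lp.single p 0 1 ∈ M)
    (hXM : ∀ t : Fin (2 * N) → ℕ, lp.single p 0 1 + block p (alternating a b) t ∈ M)
    (hYM : ∀ t : Fin (2 * N) → ℕ, block p (alternating b a) t ∈ M) (hS0 : 0 ≤ S) :
    (1 + S) ^ (1 / p.toReal) ≤ K * (1 + 2 * c) := by
  have hpp := toReal_pos_of_fact hp
  have hp0 : 0 < p := zero_lt_one.trans_le Fact.out
  have hc0 : 0 ≤ c := (abs_nonneg a).trans ha
  obtain ⟨L, hL⟩ : ∃ L, 2 * N = L + 1 := ⟨2 * N - 1, by omega⟩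
  have hsum : ∀ (g : ℝ → ℝ) (a b : ℝ),
      ∑ i ∈ Finset.range (L + 1), g (alternating a b i) = N * (g a + g b) := fun g a b => by
    rw [← hL, sum_range_alternating]
  rw [hL] at hXM hYM
  have hle1 : ∀ x : lp (fun _ : ℕ => ℝ) p, ‖x‖ ^ p.toReal ≤ 1 → ‖x‖ ≤ 1 := fun x hx =>
    (Real.rpow_le_rpow_iff (norm_nonneg _) zero_le_one hpp).1 (by rwa [Real.one_rpow])
  have halt : ∀ a b : ℝ, |a| ≤ c → |b| ≤ c → ∀ i, |alternating a b i| ≤ c := fun a b ha hb i => by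
    unfold alternating; split_ifs <;> assumption
  have hshift : ∀ a b : ℝ, (fun i => alternating a b (i + 1)) = alternating b a :=
    fun a b => funext fun i => alternating_succ a b i
  have he : ‖(lp.single p 0 1 : lp (fun _ : ℕ => ℝ) p)‖ = 1 := by
    rw [lp.norm_single hp0]; simp
  refine le_mul_of_shift_exchange hK (by positivity) hpos hlow hup h1M h0M
    (fun t => lp.single p 0 1 + block p (alternating a b) t)
    (fun t => block p (alternating b a) t) hXM hYM ?_ ?_ ?_ ?_ ?_
  · intro t ht
    rw [dist_eq_norm, add_sub_cancel_left]
    refine hle1 _ ?_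
    rw [norm_rpow_block hp _ ht.injective, hsum fun x => |x| ^ p.toReal]
    exact hab
  · intro t ht
    rw [dist_zero_right]
    refine hle1 _ ?_
    rw [norm_rpow_block hp _ ht.injective, hsum fun x => |x| ^ p.toReal, add_comm]
    exact hab
  · intro t ht
    rw [dist_eq_norm, add_sub_assoc, block_sub_block, one_div,
      Real.rpow_inv_le_iff_of_pos (by positivity) (norm_nonneg _) hpp,
      norm_rpow_single_add_block hp _ ht.injective]
    have h := sum_range_alternating (fun x => |x| ^ p.toReal) (a - b) (b - a) N
    have h' : ∀ i, alternating a b i - alternating b a i = alternating (a - b) (b - a) i :=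
      fun i => by unfold alternating; split_ifs <;> rfl
    simp only [h', hsum fun x => |x| ^ p.toReal]
    rw [abs_sub_comm b a]
    linarith
  · intro j _
    rw [dist_eq_norm, add_sub_assoc]
    have h := norm_block_init_sub_block_tail_le (p := p) _ (halt a b ha hb) j
    rw [hshift] at h
    linarith [norm_add_le (lp.single p 0 1) (block p (alternating a b) (Fin.init j) -
      block p (alternating b a) (Fin.tail j))]
  · intro j _
    rw [dist_eq_norm, add_sub_assoc]
    have h := norm_block_init_sub_block_tail_le (p := p) _ (halt b a hb ha) j
    rw [hshift, norm_sub_rev] at h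
    linarith [norm_add_le (lp.single p 0 1) (block p (alternating a b) (Fin.tail j) -
      block p (alternating b a) (Fin.init j))]

theorem exists_small_inv_rpow {q : ℝ} (hq : 0 < q) {η : ℝ} (hη : 0 < η) :
    ∃ N : ℕ, N ≠ 0 ∧ ∃ c : ℝ, 0 < c ∧ c ≤ η ∧ N * c ^ q = 1 := by
  obtain ⟨n, hn⟩ := exists_nat_gt (1 / η ^ q)
  have hn0 : (0 : ℝ) < n := lt_trans (by positivity) hn
  refine ⟨n, by exact_mod_cast hn0.ne', (1 / n : ℝ) ^ q⁻¹, by positivity, ?_, ?_⟩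
  · rw [Real.rpow_inv_le_iff_of_pos (by positivity) hη.le hq]
    rw [div_lt_iff₀ (by positivity)] at hn
    rw [div_le_iff₀ hn0]
    linarith
  · rw [Real.rpow_inv_rpow (by positivity) hq.ne']
    field_simp

theorem le_of_forall_le_mul_one_add {s K : ℝ} (h : ∀ η > 0, s ≤ K * (1 + 2 * η)) : s ≤ K := by
  have ht : Filter.Tendsto (fun η : ℝ => K * (1 + 2 * η)) (nhdsWithin 0 (Set.Ioi 0))
      (nhds (K * (1 + 2 * 0))) :=
    Filter.Tendsto.mono_left (Continuous.tendsto (by fun_prop) 0) nhdsWithin_le_nhds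
  have := ge_of_tendsto ht (by filter_upwards [self_mem_nhdsWithin] with η hη using h η hη)
  simpa using this

theorem two_rpow_add_one_le_of_lipschitzEmbeds (hp : p ≠ ∞) {K : ℝ}
    (h : LipschitzEmbeds (lp (fun _ : ℕ => ℝ) p) c0Pos K) :
    ((2 : ℝ) ^ p.toReal + 1) ^ (1 / p.toReal) ≤ K := by
  obtain ⟨f, hf⟩ := h
  have hpp := toReal_pos_of_fact hp
  have hp0 : 0 < p := zero_lt_one.trans_le Fact.out
  have hK : 0 ≤ K := by
    have h := hf (lp.single p 0 1) 0
    rw [dist_zero_right, lp.norm_single hp0, norm_one] at h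
    linarith
  refine le_of_forall_le_mul_one_add fun η hη => ?_
  obtain ⟨N, hN, c, hc0, hc, hNc⟩ := exists_small_inv_rpow hpp
    (show 0 < η * 2 ^ (p.toReal)⁻¹ by positivity)
  set d : ℝ := c / 2 ^ (p.toReal)⁻¹ with hd
  have hd0 : 0 < d := by positivity
  have hdη : d ≤ η := by rwa [hd, div_le_iff₀ (by positivity)]
  have hdp : N * d ^ p.toReal = 1 / 2 := by
    rw [hd, Real.div_rpow hc0.le (by positivity), Real.rpow_inv_rpow (by norm_num) hpp.ne']
    linarith
  have key := rpow_le_mul_of_alternating_blocks hp (M := Set.univ) (f := fun x => (f x : C₀(ℕ, ℝ)))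
    (K := K) (S := 2 ^ p.toReal) hK (fun x _ n => (f x).2 n) (fun x _ y _ => (hf x y).1)
    (fun x _ y _ => (hf x y).2) hN (a := d) (b := -d) (c := η)
    (by rwa [abs_of_pos hd0]) (by rwa [abs_neg, abs_of_pos hd0])
    (by rw [abs_neg, abs_of_pos hd0]; linarith)
    (by
      rw [sub_neg_eq_add, ← two_mul, abs_of_pos (by positivity),
        Real.mul_rpow (by norm_num) hd0.le]
      have : (N : ℝ) * (2 * (2 ^ p.toReal * d ^ p.toReal)) =
        2 * 2 ^ p.toReal * (N * d ^ p.toReal) := by ring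
      rw [this, hdp]; linarith)
    trivial trivial (fun _ => trivial) (fun _ => trivial) (by positivity)
  rwa [add_comm] at key

theorem three_rpow_le_of_lipschitzEmbeds (hp : p ≠ ∞) {K : ℝ}
    (h : LipschitzEmbeds (lpPos p) c0Pos K) : (3 : ℝ) ^ (1 / p.toReal) ≤ K := by
  classical
  obtain ⟨f, hf⟩ := h
  have hpp := toReal_pos_of_fact hp
  have hp0 : 0 < p := zero_lt_one.trans_le Fact.out
  have h0M : (0 : lp (fun _ : ℕ => ℝ) p) ∈ lpPos p := fun n => le_rfl
  have h1M : (lp.single p 0 1 : lp (fun _ : ℕ => ℝ) p) ∈ lpPos p := fun n => by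
    rw [lp.single_apply]
    by_cases h : n = 0
    · subst h; simp
    · rw [Pi.single_eq_of_ne h]
  have hK : 0 ≤ K := by
    have h := hf ⟨_, h1M⟩ ⟨_, h0M⟩
    rw [Subtype.dist_eq, dist_zero_right, lp.norm_single hp0, norm_one] at h
    linarith
  refine le_of_forall_le_mul_one_add fun η hη => ?_
  obtain ⟨N, hN, c, hc0, hc, hNc⟩ := exists_small_inv_rpow hpp hη
  let g : lp (fun _ : ℕ => ℝ) p → C₀(ℕ, ℝ) := fun x => if h : x ∈ lpPos p then f ⟨x, h⟩ else 0
  have hg : ∀ x (h : x ∈ lpPos p), g x = f ⟨x, h⟩ := fun x h => dif_pos h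
  have halt : ∀ a b : ℝ, 0 ≤ a → 0 ≤ b → ∀ i, 0 ≤ alternating a b i := fun a b ha hb i => by
    unfold alternating; split_ifs <;> assumption
  have key := rpow_le_mul_of_alternating_blocks hp (M := lpPos p) (f := g)
    (K := K) (S := 2) hK
    (fun x hx n => by rw [hg x hx]; exact (f ⟨x, hx⟩).2 n)
    (fun x hx y hy => by rw [hg x hx, hg y hy]; exact (hf ⟨x, hx⟩ ⟨y, hy⟩).1)
    (fun x hx y hy => by rw [hg x hx, hg y hy]; exact (hf ⟨x, hx⟩ ⟨y, hy⟩).2)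
    hN (a := c) (b := 0) (c := η)
    (by rwa [abs_of_pos hc0]) (by rw [abs_zero]; exact hη.le)
    (by rw [abs_zero, Real.zero_rpow hpp.ne', abs_of_pos hc0]; linarith)
    (by rw [sub_zero, abs_of_pos hc0]; linarith)
    h0M h1M
    (fun t n => add_nonneg (h1M n) (block_apply_nonneg (halt _ _ hc0.le le_rfl) t n))
    (fun t n => block_apply_nonneg (halt _ _ le_rfl hc0.le) t n) (by norm_num)
  norm_num at key
  simpa using key

end Lower

/-! ### Truncation in `ℓ_p` -/

section Truncation

variable {p : ℝ≥0∞}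

/-- The truncation of a sequence to its first `n` coordinates. -/
noncomputable def trunc (n : ℕ) (x : lp (fun _ : ℕ => ℝ) p) : lp (fun _ : ℕ => ℝ) p :=
  ∑ i ∈ Finset.range n, lp.single p i (x i)

theorem trunc_apply (n : ℕ) (x : lp (fun _ : ℕ => ℝ) p) (i : ℕ) :
    trunc n x i = if i < n then x i else 0 := by
  simp only [trunc, lp.coeFn_sum, lp.coeFn_single, Finset.sum_apply, Finset.sum_pi_single,
    Finset.mem_range]

theorem trunc_sub (n : ℕ) (x y : lp (fun _ : ℕ => ℝ) p) :
    trunc n (x - y) = trunc n x - trunc n y := by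
  simp only [trunc, ← Finset.sum_sub_distrib, ← lp.single_sub]
  rfl

theorem trunc_zero (x : lp (fun _ : ℕ => ℝ) p) : trunc 0 x = 0 := by
  simp [trunc]

theorem trunc_eq_self {n : ℕ} {x : lp (fun _ : ℕ => ℝ) p} (h : ∀ i, n ≤ i → x i = 0) :
    trunc n x = x := by
  ext i
  rw [trunc_apply]
  split_ifs with hi
  · rfl
  · exact (h i (not_lt.1 hi)).symm

variable [Fact (1 ≤ p)]

theorem norm_rpow_trunc_add (hp : p ≠ ∞) (n : ℕ) (x : lp (fun _ : ℕ => ℝ) p) :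
    ‖trunc n x‖ ^ p.toReal + ‖x - trunc n x‖ ^ p.toReal = ‖x‖ ^ p.toReal := by
  have hpp := toReal_pos_of_fact hp
  have h1 := lp.norm_sum_single (E := fun _ : ℕ => ℝ) hpp (fun i => x i) (Finset.range n)
  have h2 := lp.norm_sub_norm_compl_sub_single hpp x (Finset.range n)
  unfold trunc
  linarith

theorem norm_trunc_le (hp : p ≠ ∞) (n : ℕ) (x : lp (fun _ : ℕ => ℝ) p) : ‖trunc n x‖ ≤ ‖x‖ := by
  have hpp := toReal_pos_of_fact hp
  rw [← Real.rpow_le_rpow_iff (norm_nonneg _) (norm_nonneg _) hpp, ← norm_rpow_trunc_add hp n x]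
  exact le_add_of_nonneg_right (by positivity)

theorem norm_sub_trunc_le (hp : p ≠ ∞) {n : ℕ} (x : lp (fun _ : ℕ => ℝ) p)
    {v : lp (fun _ : ℕ => ℝ) p} (hv : ∀ i, n ≤ i → v i = 0) : ‖x - trunc n x‖ ≤ ‖x - v‖ := by
  have hpp := toReal_pos_of_fact hp
  have h : x - trunc n x = (x - v) - trunc n (x - v) := by
    rw [trunc_sub, trunc_eq_self hv]; abel
  rw [h, ← Real.rpow_le_rpow_iff (norm_nonneg _) (norm_nonneg _) hpp,
    ← norm_rpow_trunc_add hp n (x - v)]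
  exact le_add_of_nonneg_left (by positivity)

theorem norm_trunc_le_of_forall_abs_le {n : ℕ} {x : lp (fun _ : ℕ => ℝ) p} {r : ℝ}
    (h : ∀ i < n, |x i| ≤ r) : ‖trunc n x‖ ≤ n * r := by
  refine (norm_sum_le _ _).trans ?_
  have : ∀ i ∈ Finset.range n, ‖(lp.single p i (x i) : lp (fun _ : ℕ => ℝ) p)‖ ≤ r := fun i hi => by
    rw [lp.norm_single (zero_lt_one.trans_le Fact.out)]
    exact h i (Finset.mem_range.1 hi)
  simpa using Finset.sum_le_sum this

theorem separableSpace_lp (hp : p ≠ ∞) :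
    TopologicalSpace.SeparableSpace (lp (fun _ : ℕ => ℝ) p) := by
  rw [← TopologicalSpace.isSeparable_univ_iff]
  have h : TopologicalSpace.IsSeparable (Submodule.span ℝ
      (Set.range fun i : ℕ => (lp.single p i 1 : lp (fun _ : ℕ => ℝ) p)) :
      Set (lp (fun _ : ℕ => ℝ) p)) :=
    (Set.countable_range _).isSeparable.span
  refine h.closure.mono fun x _ => ?_
  refine mem_closure_of_tendsto (lp.hasSum_single hp x) (Filter.Eventually.of_forall fun s => ?_)
  refine Submodule.sum_mem _ fun i _ => ?_
  have : (lp.single p i (x i) : lp (fun _ : ℕ => ℝ) p) = x i • lp.single p i 1 := by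
    rw [← lp.single_smul]; simp
  rw [this]
  exact Submodule.smul_mem _ _ (Submodule.subset_span ⟨i, rfl⟩)

/-- The repetitions (each point is approximated by `u n` for arbitrarily large `n`) are what makes
errors tending to zero along the sequence harmless. -/
theorem exists_finitely_supported_frequently_dense (hp : p ≠ ∞) :
    ∃ u : ℕ → lp (fun _ : ℕ => ℝ) p, (∀ n i, n ≤ i → u n i = 0) ∧
      ∀ z, ∀ δ > 0, ∀ N, ∃ n ≥ N, ‖z - u n‖ < δ := by
  have := separableSpace_lp (p := p) hp
  let d := TopologicalSpace.denseSeq (lp (fun _ : ℕ => ℝ) p)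
  refine ⟨fun n => trunc n.unpair.2 (d n.unpair.1), fun n i hi => ?_, fun z δ hδ N => ?_⟩
  · rw [trunc_apply, if_neg (not_lt.2 ((Nat.unpair_right_le n).trans hi))]
  · obtain ⟨a, ha⟩ := (TopologicalSpace.denseRange_denseSeq _).exists_dist_lt z (half_pos hδ)
    have hlim := (lp.hasSum_single hp (d a)).tendsto_sum_nat
    obtain ⟨b, hb, hbN⟩ := (((Metric.tendsto_nhds.1 hlim) _ (half_pos hδ)).and
      (Filter.eventually_ge_atTop N)).exists
    refine ⟨Nat.pair a b, hbN.trans (Nat.right_le_pair a b), ?_⟩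
    rw [← dist_eq_norm]
    simp only [Nat.unpair_pair]
    have hb' : dist (trunc b (d a)) (d a) < δ / 2 := hb
    have := dist_triangle_right z (trunc b (d a)) (d a)
    have ha' : dist z (d a) < δ / 2 := ha
    linarith

end Truncation

/-! ### Bump functions separating one step of the construction -/

section Bump

/-- The `K`-Lipschitz cone of height `h` over the set `U`, cut off at `0`. -/
noncomputable def bump {E : Type*} [PseudoMetricSpace E] (K h : ℝ) (U : Set E) (z : E) : ℝ :=
  max 0 (h - K * Metric.infDist z U)

variable {E : Type*} [PseudoMetricSpace E] {K h : ℝ} {U : Set E}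

theorem bump_nonneg (z : E) : 0 ≤ bump K h U z := le_max_left _ _

theorem bump_le (hK : 0 ≤ K) (hh : 0 ≤ h) (z : E) : bump K h U z ≤ h :=
  max_le hh (sub_le_self _ (mul_nonneg hK Metric.infDist_nonneg))

theorem le_bump_of_mem {z : E} (hz : z ∈ U) : h ≤ bump K h U z := by
  rw [bump, Metric.infDist_zero_of_mem hz]
  simp

theorem abs_bump_sub_bump_le (hK : 0 ≤ K) (z w : E) :
    |bump K h U z - bump K h U w| ≤ K * dist z w := by
  have h1 : |Metric.infDist z U - Metric.infDist w U| ≤ dist z w := by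
    simpa [Real.dist_eq] using (Metric.lipschitz_infDist_pt U).dist_le_mul z w
  refine (abs_max_sub_max_le_max _ _ _ _).trans ?_
  rw [sub_self, abs_zero, sub_sub_sub_cancel_left, ← mul_sub, abs_mul, abs_of_nonneg hK,
    abs_sub_comm]
  exact max_le (by positivity) (mul_le_mul_of_nonneg_left h1 hK)

theorem bump_le_of_forall (hK : 0 < K) (hU : U.Nonempty) {z : E} {e : ℝ} (he : 0 ≤ e)
    (h' : ∀ w ∈ U, h - e ≤ K * dist z w) : bump K h U z ≤ e := by
  refine max_le he ?_
  have : (h - e) / K ≤ Metric.infDist z U :=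
    (Metric.le_infDist hU).2 fun {w} hw => by
      rw [div_le_iff₀ hK, mul_comm]; exact h' w hw
  rw [div_le_iff₀ hK] at this
  linarith

end Bump

section Step

variable {p : ℝ≥0∞} [Fact (1 ≤ p)]

/-- If pairs `(x, y)` of a bounded set are separated by their first `n` coordinates slightly better
than `dist x y / K`, finitely many bumps around the points `y` separate them all: total boundedness
allows to sort the pairs into finitely many cells in which `dist x y` and the first `n` coordinates
of `y` hardly vary. -/
theorem exists_finite_bumps (hp : p ≠ ∞)
    {S : Set (lp (fun _ : ℕ => ℝ) p × lp (fun _ : ℕ => ℝ) p)} {s R K δ : ℝ} {n : ℕ}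
    (hK : 0 < K) (hδ : 0 < δ)
    (hS : ∀ q ∈ S, dist q.1 q.2 ≤ s) (hR : ∀ q ∈ S, ‖q.2‖ ≤ R)
    (hsep : ∀ q ∈ S, dist q.1 q.2 + δ ≤ K * ‖trunc n (q.1 - q.2)‖) :
    ∃ F : Set (lp (fun _ : ℕ => ℝ) p → ℝ), F.Finite ∧
      (∀ f ∈ F, ∀ z, 0 ≤ f z ∧ f z ≤ s + δ) ∧
      (∀ f ∈ F, ∀ z w, |f z - f w| ≤ K * dist z w) ∧
      (∀ f ∈ F, ∀ v e, 0 ≤ e → (∀ q ∈ S, dist q.1 q.2 - e ≤ K * dist q.2 v) → f v ≤ e + δ) ∧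
      (∀ f ∈ F, S.Nonempty) ∧
      ∀ q ∈ S, ∃ f ∈ F, dist q.1 q.2 ≤ f q.2 - f q.1 := by
  let φ : lp (fun _ : ℕ => ℝ) p × lp (fun _ : ℕ => ℝ) p → ℝ × (Fin n → ℝ) :=
    fun q => (dist q.1 q.2, fun i => q.2 i)
  have hp0 : p ≠ 0 := (zero_lt_one.trans_le Fact.out).ne'
  have hbdd : TotallyBounded (φ '' S) := by
    refine (isCompact_closedBall (0 : ℝ × (Fin n → ℝ)) (max s (max R 0))).totallyBounded.subset ?_
    rintro _ ⟨q, hq, rfl⟩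
    rw [mem_closedBall_zero_iff, Prod.norm_def]
    refine max_le_max ?_ ?_
    · rw [Real.norm_eq_abs, abs_of_nonneg dist_nonneg]; exact hS q hq
    · rw [pi_norm_le_iff_of_nonneg (le_max_right _ _)]
      exact fun i => (lp.norm_apply_le_norm hp0 q.2 i).trans ((hR q hq).trans (le_max_left _ _))
  set τ : ℝ := δ / (2 * (1 + K * n)) with hτ
  have hKn : 0 ≤ K * n := by positivity
  have hτ0 : 0 < τ := by positivity
  have hτδ : 2 * τ + K * (n * (2 * τ)) = δ := by rw [hτ]; field_simp
  have hτδ' : 2 * τ ≤ δ := by nlinarith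
  obtain ⟨t, ht, hcov⟩ := Metric.totallyBounded_iff.1 hbdd τ hτ0
  let cell : ℝ × (Fin n → ℝ) → Set (lp (fun _ : ℕ => ℝ) p × lp (fun _ : ℕ => ℝ) p) :=
    fun c => {q ∈ S | dist (φ q) c < τ}
  have hcell : ∀ c, ∀ q ∈ cell c, |dist q.1 q.2 - c.1| < τ ∧ ∀ i : Fin n, |q.2 i - c.2 i| < τ := by
    intro c q hq
    have h := hq.2
    rw [Prod.dist_eq, max_lt_iff, dist_pi_lt_iff hτ0] at h
    exact h
  let b : ℝ × (Fin n → ℝ) → lp (fun _ : ℕ => ℝ) p → ℝ :=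
    fun c => bump K (c.1 + τ) (Prod.snd '' cell c)
  refine ⟨b '' {c ∈ t | (cell c).Nonempty}, (ht.subset (Set.sep_subset _ _)).image b, ?_, ?_, ?_,
    ?_, ?_⟩
  · rintro _ ⟨c, ⟨_, q, hq⟩, rfl⟩ z
    have h1 := abs_lt.1 (hcell c q hq).1
    have h2 := hS q hq.1
    have h3 : 0 ≤ dist q.1 q.2 := dist_nonneg
    refine ⟨bump_nonneg z, (bump_le hK.le (by linarith) z).trans (by linarith)⟩
  · rintro _ ⟨c, _, rfl⟩ z w
    exact abs_bump_sub_bump_le hK.le z w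
  · rintro _ ⟨c, ⟨_, hne⟩, rfl⟩ v e he hv
    refine bump_le_of_forall hK (hne.image _) (by linarith) ?_
    rintro _ ⟨q, hq, rfl⟩
    have h1 := abs_lt.1 (hcell c q hq).1
    have h2 := hv q hq.1
    rw [dist_comm v]
    linarith
  · rintro _ ⟨c, ⟨_, q, hq⟩, rfl⟩
    exact ⟨q, hq.1⟩
  · intro q hq
    obtain ⟨c, hct, hc⟩ := Set.mem_iUnion₂.1 (hcov (Set.mem_image_of_mem φ hq))
    have hqc : q ∈ cell c := ⟨hq, hc⟩
    refine ⟨b c, ⟨c, ⟨hct, q, hqc⟩, rfl⟩, ?_⟩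
    have h1 := abs_lt.1 (hcell c q hqc).1
    have hy : c.1 + τ ≤ b c q.2 := le_bump_of_mem (Set.mem_image_of_mem Prod.snd hqc)
    have hx : b c q.1 ≤ 0 := by
      refine bump_le_of_forall hK ((Set.nonempty_of_mem hqc).image _) le_rfl ?_
      rintro _ ⟨q', hq', rfl⟩
      have h2 : ‖trunc n (q.2 - q'.2)‖ ≤ n * (2 * τ) := by
        refine norm_trunc_le_of_forall_abs_le fun i hi => ?_
        have h3 := abs_lt.1 ((hcell c q hqc).2 ⟨i, hi⟩)
        have h4 := abs_lt.1 ((hcell c q' hq').2 ⟨i, hi⟩)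
        change |q.2 i - q'.2 i| ≤ 2 * τ
        simp only at h3 h4
        rw [abs_le]
        constructor <;> linarith
      have h3 : ‖trunc n (q.1 - q.2)‖ ≤ dist q.1 q'.2 + n * (2 * τ) := by
        have h4 : trunc n (q.1 - q.2) = trunc n (q.1 - q'.2) - trunc n (q.2 - q'.2) := by
          simp only [trunc_sub]; abel
        rw [h4, dist_eq_norm]
        linarith [norm_sub_le (trunc n (q.1 - q'.2)) (trunc n (q.2 - q'.2)),
          norm_trunc_le hp n (q.1 - q'.2)]
      have h5 := hsep q hq
      nlinarith [mul_le_mul_of_nonneg_left h3 hK.le]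
    linarith

end Step

/-! ### The embedding -/

theorem sub_trunc_mem_lpPos {p : ℝ≥0∞} {x : lp (fun _ : ℕ => ℝ) p} (hx : x ∈ lpPos p)
    (n : ℕ) :
    x - trunc n x ∈ lpPos p := by
  intro i
  change 0 ≤ x i - trunc n x i
  rw [trunc_apply]
  split_ifs
  · simp
  · simpa using hx i

section Embedding

variable {p : ℝ≥0∞} [Fact (1 ≤ p)]

/-- This is where the constant enters: of a pair at distance `s`, tails bounded by
`(A / K) * s * (1 - ε)` with `K ^ q = A ^ q + 1` leave strictly more than `s / K` for the heads. -/
theorem mul_one_add_rpow_le {q s T B A K ε : ℝ} (hq : 1 ≤ q) (hs : 0 ≤ s) (hT : 0 ≤ T)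
    (hB : 0 ≤ B) (hA : 1 ≤ A) (hK : 0 < K) (hε : 0 ≤ ε) (hε1 : ε ≤ 1) (hKA : K ^ q = A ^ q + 1)
    (hsum : T ^ q + B ^ q = s ^ q) (hle : B ≤ A * (s / K * (1 - ε))) :
    s * (1 + ε) ^ q⁻¹ ≤ K * T := by
  have hq0 : 0 < q := by linarith
  have h1 : (1 - ε) ^ q ≤ 1 - ε := by
    simpa using Real.rpow_le_rpow_of_exponent_ge' (by linarith : 0 ≤ 1 - ε) (by linarith)
      zero_le_one hq
  have hAq : 1 ≤ A ^ q := Real.one_le_rpow hA hq0.le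
  have hsq : 0 ≤ s ^ q := by positivity
  have h2 : K ^ q * B ^ q ≤ A ^ q * s ^ q * (1 - ε) := by
    have h3 : K * B ≤ A * s * (1 - ε) := by
      calc K * B ≤ K * (A * (s / K * (1 - ε))) := by gcongr
        _ = A * s * (1 - ε) := by field_simp
    have h4 := Real.rpow_le_rpow (by positivity) h3 hq0.le
    rw [Real.mul_rpow hK.le hB, Real.mul_rpow (by positivity) (by linarith),
      Real.mul_rpow (by positivity) hs] at h4
    exact h4.trans (mul_le_mul_of_nonneg_left h1 (by positivity))
  rw [← Real.rpow_le_rpow_iff (by positivity) (by positivity) hq0, Real.mul_rpow hs (by positivity),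
    Real.rpow_inv_rpow (by positivity) hq0.ne', Real.mul_rpow hK.le hT]
  have h5 : K ^ q * T ^ q = K ^ q * s ^ q - K ^ q * B ^ q := by rw [← hsum]; ring
  rw [h5, hKA]
  rw [hKA] at h2
  nlinarith [mul_nonneg (mul_nonneg hsq hε) (sub_nonneg.2 hAq)]

/-- The hypothesis on a subset of `ℓ_p` that determines its embedding constant: differences of tails
are controlled by the larger tail with factor `A`. -/
def TailBound (A : ℝ) (M : Set (lp (fun _ : ℕ => ℝ) p)) : Prop :=
  ∀ n, ∀ x ∈ M, ∀ y ∈ M,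
    ‖(x - y) - trunc n (x - y)‖ ≤ A * max ‖x - trunc n x‖ ‖y - trunc n y‖

/-- All pairs of points at distance between `s` and `2 * s` are separated by countably many bump
functions. The index of a point is the first `n` for which `u n` is closer than `d / K * (1 - ε n)`,
where `d` is the distance of the pair, and the bump is placed around the point with the *larger*
index: then both tails beyond `n` are small, while all earlier `u i` are so far from the centre that
the bump almost vanishes there. -/
theorem exists_countable_bumps (hp : p ≠ ∞) {M : Set (lp (fun _ : ℕ => ℝ) p)} {A K s : ℝ}
    (hA : 1 ≤ A) (hK : 0 < K) (hKA : K ^ p.toReal = A ^ p.toReal + 1) (hM : TailBound A M)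
    (hs : 0 < s) {u : ℕ → lp (fun _ : ℕ => ℝ) p} (hu : ∀ n i, n ≤ i → u n i = 0)
    (hdense : ∀ z, ∀ δ > 0, ∀ N, ∃ n ≥ N, ‖z - u n‖ < δ)
    {ε : ℕ → ℝ} (hε : ∀ n, 0 < ε n) (hε2 : ∀ n, ε n ≤ 1 / 2) (hanti : Antitone ε)
    (hlim : Filter.Tendsto ε Filter.atTop (nhds 0)) :
    ∃ F : Set (lp (fun _ : ℕ => ℝ) p → ℝ), F.Countable ∧
      (∀ f ∈ F, ∀ z, 0 ≤ f z ∧ f z ≤ 3 * s) ∧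
      (∀ f ∈ F, ∀ z w, |f z - f w| ≤ K * dist z w) ∧
      (∀ z, ∀ η > 0, {f ∈ F | η ≤ f z}.Finite) ∧
      (∀ f ∈ F, ∀ i, (∀ i' ≤ i, ‖u i'‖ ≤ (1 / A - 1 / K) * s) → f (u i) ≤ 3 * s * ε i) ∧
      ∀ x ∈ M, ∀ y ∈ M, s ≤ dist x y → dist x y ≤ 2 * s →
        ∃ f ∈ F, dist x y ≤ |f x - f y| := by
  have hq := one_le_toReal_of_fact hp
  have hA0 : 0 < A := by linarith
  let near : ℝ → ℕ → lp (fun _ : ℕ => ℝ) p → Prop := fun d i x => ‖x - u i‖ < d / K * (1 - ε i)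
  let S : ℕ → Set (lp (fun _ : ℕ => ℝ) p × lp (fun _ : ℕ => ℝ) p) := fun n =>
    {q | q.1 ∈ M ∧ q.2 ∈ M ∧ s ≤ dist q.1 q.2 ∧ dist q.1 q.2 ≤ 2 * s ∧
      near (dist q.1 q.2) n q.2 ∧ (∀ i < n, ¬ near (dist q.1 q.2) i q.2) ∧
      ∃ m ≤ n, near (dist q.1 q.2) m q.1}
  let δ : ℕ → ℝ := fun n => min (s * ((1 + ε n) ^ (p.toReal)⁻¹ - 1)) (s * ε n)
  have hδ : ∀ n, 0 < δ n := fun n => by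
    have h1 : 1 < (1 + ε n) ^ (p.toReal)⁻¹ :=
      Real.one_lt_rpow (by linarith [hε n]) (by positivity)
    exact lt_min (mul_pos hs (by linarith)) (mul_pos hs (hε n))
  have hstep : ∀ n, _ := fun n => exists_finite_bumps hp (S := S n) (s := 2 * s)
    (R := ‖u n‖ + 2 * s / K) (K := K) (δ := δ n) (n := n) hK (hδ n)
    (fun q hq => hq.2.2.2.1)
    (by
      rintro q ⟨-, -, -, h2s, hn, -⟩
      have h1 : ‖q.2 - u n‖ < dist q.1 q.2 / K * (1 - ε n) := hn
      have h2 : dist q.1 q.2 / K * (1 - ε n) ≤ dist q.1 q.2 / K :=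
        mul_le_of_le_one_right (by positivity) (by linarith [hε n])
      have h3 : dist q.1 q.2 / K ≤ 2 * s / K := by gcongr
      have h4 := norm_le_norm_add_norm_sub (u n) q.2
      rw [norm_sub_rev] at h4
      linarith)
    (by
      rintro q ⟨h1M, h2M, hsd, h2s, hn, -, m, hm, hnm⟩
      have h1 : ‖q.2 - u n‖ < dist q.1 q.2 / K * (1 - ε n) := hn
      have h2 : ‖q.1 - u m‖ < dist q.1 q.2 / K * (1 - ε m) := hnm
      have h3 : dist q.1 q.2 / K * (1 - ε m) ≤ dist q.1 q.2 / K * (1 - ε n) := by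
        have := hanti hm
        gcongr
      have h4 := norm_sub_trunc_le hp q.2 (hu n)
      have h5 := norm_sub_trunc_le hp q.1 (fun i hi => hu m i (hm.trans hi))
      have h6 := mul_one_add_rpow_le hq dist_nonneg (norm_nonneg _) (norm_nonneg _) hA hK
        (hε n).le (by linarith [hε2 n]) hKA
        (by rw [dist_eq_norm]; exact norm_rpow_trunc_add hp n (q.1 - q.2))
        ((hM n _ h1M _ h2M).trans (mul_le_mul_of_nonneg_left
          (max_le (h5.trans (h2.le.trans h3)) (h4.trans h1.le)) hA0.le))
      have h7 : δ n ≤ dist q.1 q.2 * ((1 + ε n) ^ (p.toReal)⁻¹ - 1) :=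
        (min_le_left _ _).trans (mul_le_mul_of_nonneg_right hsd
          (sub_nonneg.2 (Real.one_le_rpow (by linarith [hε n]) (by positivity))))
      linarith)
  choose F hfin hbd hL hv hne hsepF using hstep
  have hzero : ∀ n, ∀ f ∈ F n, ∀ i < n, f (u i) ≤ 3 * s * ε i := by
    intro n f hf i hi
    have h1 := hv n f hf (u i) (2 * s * ε i) (by have := hε i; positivity) (by
      rintro q ⟨-, -, -, h2s, -, hnot, -⟩
      have h2 : dist q.1 q.2 / K * (1 - ε i) ≤ dist q.2 (u i) := by
        rw [dist_eq_norm q.2]; exact not_lt.1 (hnot i hi)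
      have h3 : K * (dist q.1 q.2 / K * (1 - ε i)) = dist q.1 q.2 - dist q.1 q.2 * ε i := by
        field_simp
      have h4 := mul_le_mul_of_nonneg_left h2 hK.le
      have h5 := mul_le_mul_of_nonneg_right h2s (hε i).le
      linarith)
    have h6 : δ n ≤ s * ε i :=
      (min_le_right _ _).trans (mul_le_mul_of_nonneg_left (hanti hi.le) hs.le)
    linarith
  refine ⟨⋃ n, F n, Set.countable_iUnion fun n => (hfin n).countable, ?_, ?_, ?_, ?_, ?_⟩
  · intro f hf z
    obtain ⟨n, hn⟩ := Set.mem_iUnion.1 hf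
    have h1 := hbd n f hn z
    have h2 : δ n ≤ s * ε n := min_le_right _ _
    have h3 := mul_le_mul_of_nonneg_left (hε2 n) hs.le
    exact ⟨h1.1, by linarith⟩
  · intro f hf
    obtain ⟨n, hn⟩ := Set.mem_iUnion.1 hf
    exact hL n f hn
  · intro z η hη
    obtain ⟨N, hN⟩ := Filter.eventually_atTop.1
      (hlim.eventually_lt_const (show 0 < η / (6 * s) by positivity))
    obtain ⟨i, hiN, hi⟩ := hdense z (η / (2 * K)) (by positivity) N
    refine (Set.Finite.biUnion (Set.finite_Iic i) fun n _ => hfin n).subset ?_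
    rintro f ⟨hf, hηf⟩
    obtain ⟨n, hn⟩ := Set.mem_iUnion.1 hf
    refine Set.mem_biUnion (show n ∈ Set.Iic i from ?_) hn
    by_contra hin
    have h1 := hzero n f hn i (not_le.1 hin)
    have h2 := (abs_le.1 (hL n f hn z (u i))).2
    rw [dist_eq_norm] at h2
    have h3 := hN i hiN
    rw [lt_div_iff₀ (by positivity)] at h3 hi
    linarith
  · intro f hf i hi
    obtain ⟨n, hn⟩ := Set.mem_iUnion.1 hf
    refine hzero n f hn i ?_
    by_contra! hin
    -- otherwise both points of some pair lie too close to the origin for their distance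
    obtain ⟨q, h1M, h2M, hsd, -, hqn, -, m, hm, hqm⟩ := hne n f hn
    have hd0 : 0 < dist q.1 q.2 := hs.trans_le hsd
    have hc : 0 ≤ 1 / A - 1 / K := by
      by_contra! hneg
      have := hi 0 (Nat.zero_le _)
      nlinarith [norm_nonneg (u 0)]
    have hsmall : ∀ x, ∀ k ≤ i, near (dist q.1 q.2) k x → ‖x‖ < dist q.1 q.2 / A := by
      intro x k hk hx
      have h1 : ‖x - u k‖ < dist q.1 q.2 / K * (1 - ε k) := hx
      have h2 : dist q.1 q.2 / K * (1 - ε k) ≤ dist q.1 q.2 / K :=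
        mul_le_of_le_one_right (by positivity) (by linarith [hε k])
      have h3 := (hi k hk).trans (mul_le_mul_of_nonneg_left hsd hc)
      have h4 := norm_le_norm_add_norm_sub (u k) x
      rw [norm_sub_rev] at h4
      have h5 : (1 / A - 1 / K) * dist q.1 q.2 = dist q.1 q.2 / A - dist q.1 q.2 / K := by ring
      linarith
    have h1 := hM 0 _ h1M _ h2M
    simp only [trunc_zero, sub_zero] at h1
    have h2 := max_lt (hsmall q.1 m (hm.trans hin) hqm) (hsmall q.2 n hin hqn)
    rw [← dist_eq_norm] at h1
    rw [lt_div_iff₀ hA0] at h2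
    linarith
  · intro x hx y hy hsd h2s
    have hex : ∀ z, ∃ n, near (dist x y) n z := by
      intro z
      have hd0 : 0 < dist x y := hs.trans_le hsd
      obtain ⟨n, -, hn⟩ := hdense z (dist x y / K * (1 / 2)) (by positivity) 0
      refine ⟨n, hn.trans_le ?_⟩
      have := hε2 n
      gcongr
      linarith
    have hmem : ∀ x' ∈ M, ∀ y' ∈ M, dist x' y' = dist x y → ∀ m n, m ≤ n →
        near (dist x y) m x' → near (dist x y) n y' → (∀ i < n, ¬ near (dist x y) i y') →
        ∃ f ∈ ⋃ n, F n, dist x y ≤ f y' - f x' := by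
      intro x' hx y' hy hd m n hmn hmx hny hmin
      rw [← hd] at hsd h2s hmx hny hmin ⊢
      obtain ⟨f, hf, hle⟩ := hsepF n (x', y') ⟨hx, hy, hsd, h2s, hny, hmin, m, hmn, hmx⟩
      exact ⟨f, Set.mem_iUnion.2 ⟨n, hf⟩, hle⟩
    classical
    rcases le_total (Nat.find (hex x)) (Nat.find (hex y)) with h | h
    · obtain ⟨f, hf, hle⟩ := hmem x hx y hy rfl _ _ h (Nat.find_spec (hex x))
        (Nat.find_spec (hex y)) fun i hi => Nat.find_min (hex y) hi
      exact ⟨f, hf, hle.trans (by rw [abs_sub_comm]; exact le_abs_self _)⟩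
    · obtain ⟨f, hf, hle⟩ := hmem y hy x hx (dist_comm y x) _ _ h (Nat.find_spec (hex y))
        (Nat.find_spec (hex x)) fun i hi => Nat.find_min (hex x) hi
      exact ⟨f, hf, hle.trans (le_abs_self _)⟩

/-- The families belonging to the distances `2 ^ k ≤ dist x y ≤ 2 ^ (k + 1)`, `k : ℤ`, are put
together. For `k → -∞` the functions are uniformly small; for `k → ∞` they are small at more and
more of the points `u i`, hence at every point. -/
theorem lipschitzEmbeds_of_tailBound (hp : p ≠ ∞) {M : Set (lp (fun _ : ℕ => ℝ) p)} {A K : ℝ}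
    (hA : 1 ≤ A) (hK : 0 < K) (hKA : K ^ p.toReal = A ^ p.toReal + 1) (hM : TailBound A M) :
    LipschitzEmbeds M c0Pos K := by
  have hpp := toReal_pos_of_fact hp
  have hA0 : 0 < A := by linarith
  have hAK : A < K := by
    rw [← Real.rpow_lt_rpow_iff hA0.le hK.le hpp, hKA]; linarith
  have hc : 0 < 1 / A - 1 / K := sub_pos.2 (one_div_lt_one_div_of_lt hA0 hAK)
  obtain ⟨u, hu, hdense⟩ := exists_finitely_supported_frequently_dense (p := p) hp
  -- the factor `4⁻ᵏ` beats the size `2ᵏ` of the functions of scale `k`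
  let ε : ℤ → ℕ → ℝ := fun k i => (1 / 4) ^ k.toNat * (1 / ((i : ℝ) + 2))
  have hε2' : ∀ i : ℕ, 1 / ((i : ℝ) + 2) ≤ 1 / 2 := fun i =>
    one_div_le_one_div_of_le two_pos (by linarith [(Nat.cast_nonneg i : (0 : ℝ) ≤ i)])
  have hε4 : ∀ k : ℤ, (1 / 4 : ℝ) ^ k.toNat ≤ 1 := fun k =>
    pow_le_one₀ (by norm_num) (by norm_num)
  choose F hcount hbd hL hfin hsmall hsep using fun k : ℤ =>
    exists_countable_bumps hp hA hK hKA hM (s := 2 ^ k) (by positivity) hu hdense (ε := ε k)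
      (fun n => by positivity)
      (fun n => (mul_le_of_le_one_left (by positivity) (hε4 k)).trans (hε2' n))
      (fun m n hmn => by
        have : (m : ℝ) ≤ n := by exact_mod_cast hmn
        dsimp only [ε]
        gcongr)
      (by
        have h : Filter.Tendsto (fun n : ℕ => 1 / ((n : ℝ) + 2)) Filter.atTop (nhds 0) :=
          tendsto_const_nhds.div_atTop
            (Filter.tendsto_atTop_add_const_right _ _ tendsto_natCast_atTop_atTop)
        have h' := h.const_mul ((1 / 4 : ℝ) ^ k.toNat)
        rwa [mul_zero] at h')
  have : Countable (⋃ k, F k : Set (lp (fun _ : ℕ => ℝ) p → ℝ)) :=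
    (Set.countable_iUnion hcount).to_subtype
  have hF : ∀ f : (⋃ k, F k : Set (lp (fun _ : ℕ => ℝ) p → ℝ)), ∃ k, f.1 ∈ F k :=
    fun f => Set.mem_iUnion.1 f.2
  refine lipschitzEmbeds_c0Pos_of_family hK.le
    (fun (f : (⋃ k, F k : Set (lp (fun _ : ℕ => ℝ) p → ℝ))) (x : M) => f.1 x) ?_ ?_ ?_ ?_
  · intro f z
    obtain ⟨k, hk⟩ := hF f
    exact (hbd k _ hk z).1
  · intro f x y
    obtain ⟨k, hk⟩ := hF f
    exact hL k _ hk x y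
  · intro z η hη
    obtain ⟨i, -, hi⟩ := hdense z (η / (2 * K)) (by positivity) 0
    rw [lt_div_iff₀ (by positivity)] at hi
    have hhalf : Filter.Tendsto (fun n : ℕ => 3 * (1 / 2 : ℝ) ^ n) Filter.atTop (nhds 0) := by
      simpa using (tendsto_pow_atTop_nhds_zero_of_lt_one (r := (1 / 2 : ℝ)) (by norm_num)
        (by norm_num)).const_mul 3
    have hbig : Filter.Tendsto (fun n : ℕ => (1 / A - 1 / K) * (2 : ℝ) ^ n) Filter.atTop
        Filter.atTop :=
      (tendsto_pow_atTop_atTop_of_one_lt one_lt_two).const_mul_atTop hc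
    obtain ⟨N, hN⟩ := Filter.eventually_atTop.1
      ((hhalf.eventually_lt_const (half_pos hη)).and
        (hbig.eventually_ge_atTop (∑ i' ∈ Finset.range (i + 1), ‖u i'‖)))
    have hbounds : ∀ k, ∀ f ∈ F k, η ≤ f z → k ∈ Set.Icc (-N : ℤ) N := by
      intro k f hf hηf
      constructor
      · by_contra! hlt
        obtain ⟨n, rfl⟩ : ∃ n : ℕ, k = -n := ⟨k.natAbs, by omega⟩
        have h1 := (hbd _ f hf z).2
        have h2 := (hN n (by omega)).1
        rw [one_div, inv_pow] at h2
        rw [zpow_neg, zpow_natCast] at h1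
        linarith
      · by_contra! hlt
        obtain ⟨n, rfl⟩ : ∃ n : ℕ, k = n := ⟨k.natAbs, by omega⟩
        obtain ⟨h1, h2⟩ := hN n (by omega)
        have h3 := hsmall _ f hf i (fun i' hi' => by
          rw [zpow_natCast]
          exact (Finset.single_le_sum (f := fun i => ‖u i‖) (fun _ _ => norm_nonneg _)
            (Finset.mem_range.2 (by omega))).trans h2)
        have h4 : 3 * (2 : ℝ) ^ (n : ℤ) * ε n i ≤ 3 * (1 / 2) ^ n := by
          have h5 : (2 : ℝ) ^ n * (1 / 4) ^ n = (1 / 2) ^ n := by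
            rw [← mul_pow]; norm_num
          have h6 : (0 : ℝ) < (1 / 2) ^ n := by positivity
          have h7 : 3 * (2 : ℝ) ^ (n : ℤ) * ε n i = 3 * (1 / 2) ^ n * (1 / ((i : ℝ) + 2)) := by
            simp only [ε, Int.toNat_natCast, zpow_natCast, ← h5]; ring
          rw [h7]
          exact mul_le_of_le_one_right (by positivity) ((hε2' i).trans (by norm_num))
        have h8 := (abs_le.1 (hL _ f hf z (u i))).2
        rw [dist_eq_norm] at h8
        linarith
    have hfinite : (⋃ k ∈ Set.Icc (-N : ℤ) N, {f ∈ F k | η ≤ f z}).Finite :=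
      (Set.finite_Icc _ _).biUnion fun k _ => hfin k z η hη
    refine (hfinite.preimage Subtype.val_injective.injOn).subset fun f hf => ?_
    obtain ⟨k, hk⟩ := hF f
    exact Set.mem_biUnion (hbounds k f.1 hk hf) ⟨hk, hf⟩
  · intro x y hxy
    obtain ⟨k, hk⟩ := exists_mem_Ico_zpow (dist_pos.2 hxy) (one_lt_two (α := ℝ))
    obtain ⟨f, hf, hle⟩ := hsep k x x.2 y y.2 hk.1
      (by have := hk.2.le; rwa [zpow_add_one₀ two_ne_zero, mul_comm] at this)
    exact ⟨⟨f, Set.mem_iUnion.2 ⟨k, hf⟩⟩, hle⟩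

theorem tailBound_univ : TailBound 2 (Set.univ : Set (lp (fun _ : ℕ => ℝ) p)) := by
  intro n x _ y _
  rw [trunc_sub, sub_sub_sub_comm]
  refine (norm_sub_le _ _).trans ?_
  linarith [le_max_left ‖x - trunc n x‖ ‖y - trunc n y‖,
    le_max_right ‖x - trunc n x‖ ‖y - trunc n y‖]

theorem norm_sub_rpow_le_of_mem_lpPos (hp : p ≠ ∞) {x y : lp (fun _ : ℕ => ℝ) p}
    (hx : x ∈ lpPos p) (hy : y ∈ lpPos p) :
    ‖x - y‖ ^ p.toReal ≤ ‖x‖ ^ p.toReal + ‖y‖ ^ p.toReal := by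
  have hpp := toReal_pos_of_fact hp
  refine hasSum_le (fun i => ?_) (lp.hasSum_norm hpp (x - y))
    ((lp.hasSum_norm hpp x).add (lp.hasSum_norm hpp y))
  have hxi : 0 ≤ x i := hx i
  have hyi : 0 ≤ y i := hy i
  change |x i - y i| ^ p.toReal ≤ |x i| ^ p.toReal + |y i| ^ p.toReal
  rw [abs_of_nonneg hxi, abs_of_nonneg hyi]
  rcases le_total (x i) (y i) with h | h
  · rw [abs_sub_comm, abs_of_nonneg (sub_nonneg.2 h)]
    exact (Real.rpow_le_rpow (sub_nonneg.2 h) (by linarith) hpp.le).trans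
      (le_add_of_nonneg_left (by positivity))
  · rw [abs_of_nonneg (sub_nonneg.2 h)]
    exact (Real.rpow_le_rpow (sub_nonneg.2 h) (by linarith) hpp.le).trans
      (le_add_of_nonneg_right (by positivity))

theorem tailBound_lpPos (hp : p ≠ ∞) : TailBound (2 ^ (1 / p.toReal)) (lpPos p) := by
  have hpp := toReal_pos_of_fact hp
  intro n x hx y hy
  rw [trunc_sub, sub_sub_sub_comm]
  have h := norm_sub_rpow_le_of_mem_lpPos hp (sub_trunc_mem_lpPos hx n) (sub_trunc_mem_lpPos hy n)
  set a := ‖x - trunc n x‖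
  set b := ‖y - trunc n y‖
  have ha : a ^ p.toReal ≤ max a b ^ p.toReal :=
    Real.rpow_le_rpow (norm_nonneg _) (le_max_left _ _) hpp.le
  have hb : b ^ p.toReal ≤ max a b ^ p.toReal :=
    Real.rpow_le_rpow (norm_nonneg _) (le_max_right _ _) hpp.le
  have hab : 0 ≤ max a b := (norm_nonneg _).trans (le_max_left _ _)
  rw [← Real.rpow_le_rpow_iff (norm_nonneg _) (by positivity) hpp,
    Real.mul_rpow (by positivity) hab, one_div, Real.rpow_inv_rpow zero_le_two hpp.ne']
  linarith

end Embedding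

theorem LipschitzEmbeds.of_univ {X Y : Type*} [MetricSpace X] [MetricSpace Y] {K : ℝ}
    (h : LipschitzEmbeds (Set.univ : Set X) Y K) : LipschitzEmbeds X Y K := by
  obtain ⟨f, hf⟩ := h
  exact ⟨fun x => f ⟨x, trivial⟩, fun x y => hf ⟨x, trivial⟩ ⟨y, trivial⟩⟩

theorem theorem5p2 (p : ℝ≥0∞) [Fact (1 ≤ p)] (hp : p ≠ ∞) :
    IsLeast {K : ℝ | LipschitzEmbeds (lp (fun _ : ℕ => ℝ) p) c0Pos K}
      (((2 : ℝ) ^ p.toReal + 1) ^ (1 / p.toReal)) ∧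
    IsLeast {K : ℝ | LipschitzEmbeds (lpPos p) c0Pos K}
      ((3 : ℝ) ^ (1 / p.toReal)) := by
  have hpp := toReal_pos_of_fact hp
  refine ⟨⟨?_, fun K hK => two_rpow_add_one_le_of_lipschitzEmbeds hp hK⟩,
    ⟨?_, fun K hK => three_rpow_le_of_lipschitzEmbeds hp hK⟩⟩
  · refine (lipschitzEmbeds_of_tailBound hp one_le_two (by positivity) ?_ tailBound_univ).of_univ
    rw [one_div, Real.rpow_inv_rpow (by positivity) hpp.ne']
  · refine lipschitzEmbeds_of_tailBound hp (Real.one_le_rpow one_le_two (by positivity))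
      (by positivity) ?_ (tailBound_lpPos hp)
    rw [one_div, Real.rpow_inv_rpow (by positivity) hpp.ne',
      Real.rpow_inv_rpow (by positivity) hpp.ne']
    norm_num
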